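/- Let $S$ be a simple inverse $\omega$-semigroup (that is: every $x\in S$ has a unique $y\in S$ with $xyx=x$ and $yxy=y$; $S$ has no proper two-sided ideals; and the set of idempotents of $S$, ordered by $e\preccurlyeq f\iff ef=fe=e$, is order isomorphic to $(\{0,1,2,\dots\},\geq)$). Suppose that $S$ is equipped with a Hausdorff topology in which multiplication is separately continuous and in which every maximal subgroup of $S$ is compact. Let $S_I=S\sqcup I$ be a semigroup that contains $S$ as a subsemigroup and in which $I=S_I\setminus S$ is a two-sided ideal. Let $\tau$ be a Hausdorff locally compact topology on $S_I$ which makes the multiplication $S_I\times S_I\to S_I$ jointly continuous, which induces on $S$ its given topology, and in which $I$ is compact. Then $I$ is open in $(S_I,\tau)$. -/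

import Mathlib

namespace SemigroupTheory

/-- Closure under left and right multiplication by arbitrary elements: the set `J` is a two-sided
ideal of the semigroup `S`. Non-emptiness is required separately where it matters. -/
def IsTwoSidedIdeal {S : Type*} [Semigroup S] (J : Set S) : Prop :=
  ∀ a : S, ∀ x ∈ J, a * x ∈ J ∧ x * a ∈ J

/-- The semigroup `S` has no proper two-sided ideals. -/
def IsSimple (S : Type*) [Semigroup S] : Prop :=
  ∀ J : Set S, J.Nonempty → IsTwoSidedIdeal J → J = Set.univ

/-- Every element of the semigroup `S` has a unique inverse. -/
def IsInverse (S : Type*) [Semigroup S] : Prop :=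
  ∀ x : S, ∃! y : S, x * y * x = x ∧ y * x * y = y

/-- The natural partial order on the set of idempotents of a semigroup. -/
def IdempotentLE {S : Type*} [Semigroup S] (e f : {e : S // IsIdempotentElem e}) : Prop :=
  (e : S) * f = e ∧ (f : S) * e = e

/-- The set of idempotents of `S`, with the natural partial order, is order isomorphic
to the non-negative integers with the order `≥`. -/
def IsOmegaSemigroup (S : Type*) [Semigroup S] : Prop :=
  Nonempty ((IdempotentLE (S := S)) ≃r (fun m n : ℕ => m ≥ n))

/-- The subset `H` of the semigroup `S` is a group under the multiplication of `S`. -/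
def IsSubgroup {S : Type*} [Semigroup S] (H : Set S) : Prop :=
  (∀ x ∈ H, ∀ y ∈ H, x * y ∈ H) ∧
    ∃ e ∈ H, (∀ x ∈ H, e * x = x ∧ x * e = x) ∧ ∀ x ∈ H, ∃ y ∈ H, x * y = e ∧ y * x = e

/-- The subset `H` of `S` is a subgroup that is not properly contained in another one. -/
def IsMaximalSubgroup {S : Type*} [Semigroup S] (H : Set S) : Prop :=
  Maximal IsSubgroup H

end SemigroupTheory

/-! Simplicity yields `p * q = 1` with `q * p ≠ 1`, and the idempotents `qⁿpⁿ` decrease past every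
idempotent. So each point eventually leaves both `Spⁿ` and `qⁿS`, while for fixed `n` the points
outside both lie in finitely many H-classes, hence in a compact set (`exists_isCompact_of_mul_ne`).
In `isOpen_of_isCompact_ideal`, take a compact neighbourhood `U` of `I`. For large `N`, right
multiplication by `p` keeps `U ∩ q^N S` in `U`, and left multiplication by `q` keeps `U ∩ Sp^N` in
`U`. If `I` is not open, some `x` starts both orbits `x pⁿ` and `qⁿ y`, with `y = x p^N`. Their
limits multiply to `x y ∉ I`, so the limit of `x pⁿ` lies in `S`; but it would lie in every `Spᵐ`.
-/

namespace SemigroupTheory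

/-! ### Idempotents, H-classes and maximal subgroups -/

section Algebra

variable {S : Type*} [Semigroup S]

/-- In an `ω`-semigroup any two idempotents are comparable. -/
theorem IsOmegaSemigroup.idempotentLE_total (h : IsOmegaSemigroup S)
    (e f : {e : S // IsIdempotentElem e}) : IdempotentLE e f ∨ IdempotentLE f e := by
  obtain ⟨φ⟩ := h
  rw [← φ.map_rel_iff, ← φ.map_rel_iff]
  exact le_total _ _

/-- Only finitely many idempotents of an `ω`-semigroup are not below a given one. -/
theorem IsOmegaSemigroup.finite_not_idempotentLE (h : IsOmegaSemigroup S)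
    (f : {e : S // IsIdempotentElem e}) : {e | ¬ IdempotentLE e f}.Finite := by
  obtain ⟨φ⟩ := h
  refine ((Set.finite_lt_nat (φ f)).preimage φ.injective.injOn).subset fun e he => ?_
  have : ¬ φ e ≥ φ f := fun hle => he (φ.map_rel_iff.1 hle)
  exact not_le.1 this

/-- A strictly decreasing sequence of idempotents of an `ω`-semigroup has no lower bound. -/
theorem IsOmegaSemigroup.exists_not_idempotentLE (h : IsOmegaSemigroup S)
    (f : ℕ → {e : S // IsIdempotentElem e}) (hle : ∀ n, IdempotentLE (f (n + 1)) (f n))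
    (hne : ∀ n, f (n + 1) ≠ f n) (e : {e : S // IsIdempotentElem e}) :
    ∃ n, ¬ IdempotentLE e (f n) := by
  obtain ⟨φ⟩ := h
  have hmono : StrictMono fun n => φ (f n) := strictMono_nat_of_lt_succ fun n =>
    lt_of_le_of_ne (φ.map_rel_iff.2 (hle n)) fun heq => hne n (φ.injective heq.symm)
  -- A strictly increasing sequence of naturals satisfies `n ≤ φ (f n)`, so this index overshoots `φ
  -- e`.
  refine ⟨φ e + 1, fun hcon => ?_⟩
  have h1 : φ e ≥ φ (f (φ e + 1)) := φ.map_rel_iff.2 hcon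
  have h2 := hmono.id_le (φ e + 1)
  simp only [id] at h2
  omega

/-- The group of units of the local monoid `fSf`. -/
def unitsAt (f : S) : Set S :=
  {u | f * u = u ∧ u * f = u ∧ ∃ v, f * v = v ∧ v * f = v ∧ u * v = f ∧ v * u = f}

theorem isSubgroup_unitsAt {f : S} (hf : IsIdempotentElem f) : IsSubgroup (unitsAt f) := by
  refine ⟨?_, f, ⟨hf, hf, f, hf, hf, hf, hf⟩, fun x hx => ⟨hx.1, hx.2.1⟩, ?_⟩
  · rintro x ⟨fx, xf, x', fx', xf', h1, h2⟩ y ⟨fy, yf, y', fy', yf', h3, h4⟩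
    refine ⟨by rw [← mul_assoc, fx], by rw [mul_assoc, yf], y' * x',
      by rw [← mul_assoc, fy'], by rw [mul_assoc, xf'], ?_, ?_⟩
    · rw [mul_assoc, ← mul_assoc y, h3, fx', h1]
    · rw [mul_assoc, ← mul_assoc x', h2, fy, h4]
  · rintro x ⟨fx, xf, v, fv, vf, h1, h2⟩
    exact ⟨v, ⟨fv, vf, x, fx, xf, h2, h1⟩, h1, h2⟩

theorem isMaximalSubgroup_unitsAt {f : S} (hf : IsIdempotentElem f) :
    IsMaximalSubgroup (unitsAt f) := by
  refine ⟨isSubgroup_unitsAt hf, ?_⟩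
  rintro H ⟨-, e, -, heH, hinvH⟩ hsub x hx
  have hfH : f ∈ H := hsub ⟨hf, hf, f, hf, hf, hf, hf⟩
  obtain ⟨v, -, hv, -⟩ := hinvH f hfH
  have hfe : f = e := by
    calc f = f * e := (heH f hfH).2.symm
      _ = f * f * v := by rw [mul_assoc, hv]
      _ = e := by rw [hf.eq, hv]
  subst hfe
  obtain ⟨y, hy, hxy, hyx⟩ := hinvH x hx
  exact ⟨(heH x hx).1, (heH x hx).2, y, (heH y hy).1, (heH y hy).2, hxy, hyx⟩

/-- The `H`-class of the elements with left idempotent `e` and right idempotent `f`. -/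
def hClass (e f : S) : Set S :=
  {x | ∃ y, x * y * x = x ∧ y * x * y = y ∧ x * y = e ∧ y * x = f}

/-- As in Green's lemma, `x = s (t x)`, and `t x` is a unit at `f` with inverse `y s`. -/
theorem hClass_subset_image {e f s t : S} (hst : s * t * s = s) (hts : t * s * t = t)
    (he : s * t = e) (hf : t * s = f) : hClass e f ⊆ (s * ·) '' unitsAt f := by
  rintro x ⟨y, hx, hy, rfl, hyx⟩
  refine ⟨t * x, ⟨?_, ?_, y * s, ?_, ?_, ?_, ?_⟩, ?_⟩
  · rw [← hf, ← mul_assoc, hts]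
  · rw [← hyx, mul_assoc, ← mul_assoc x, hx]
  · rw [← hyx, ← mul_assoc, hy]
  · rw [← hf, mul_assoc, ← mul_assoc s, hst]
  · rw [mul_assoc, ← mul_assoc x, ← he, hst, hf]
  · rw [mul_assoc, ← mul_assoc s, he, hx, hyx]
  · change s * (t * x) = x
    rw [← mul_assoc, he, hx]

/-- Each `H`-class lies in a translate of a maximal subgroup. -/
theorem exists_isCompact_hClass_subset [TopologicalSpace S] [SeparatelyContinuousMul S]
    (hcompact : ∀ H : Set S, IsMaximalSubgroup H → IsCompact H) (e f : S) :
    ∃ C, IsCompact C ∧ hClass e f ⊆ C := by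
  obtain h | ⟨s, t, hst, hts, he, hf⟩ := (hClass e f).eq_empty_or_nonempty
  · exact ⟨∅, isCompact_empty, h.subset⟩
  · have hidem : IsIdempotentElem f := by
      rw [← hf, IsIdempotentElem, ← mul_assoc, hts]
    exact ⟨_, (hcompact _ (isMaximalSubgroup_unitsAt hidem)).image (continuous_const_mul s),
      hClass_subset_image hst hts he hf⟩

/-- The elements lying neither in `fS` nor in `Sf` form a relatively compact set. -/
theorem exists_isCompact_of_mul_ne [TopologicalSpace S] [SeparatelyContinuousMul S]
    (hinv : IsInverse S) (homega : IsOmegaSemigroup S)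
    (hcompact : ∀ H : Set S, IsMaximalSubgroup H → IsCompact H)
    {f : S} (hf : IsIdempotentElem f) :
    ∃ C, IsCompact C ∧ ∀ x, x * f ≠ x → f * x ≠ x → x ∈ C := by
  choose K hK hsub using exists_isCompact_hClass_subset hcompact
  have hfin := homega.finite_not_idempotentLE ⟨f, hf⟩
  refine ⟨⋃ a ∈ {e | ¬ IdempotentLE e ⟨f, hf⟩}, ⋃ b ∈ {e | ¬ IdempotentLE e ⟨f, hf⟩}, K a b,
    hfin.isCompact_biUnion fun a _ => hfin.isCompact_biUnion fun b _ => hK _ _, ?_⟩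
  intro x hxf hfx
  obtain ⟨y, ⟨hx, hy⟩, -⟩ := hinv x
  have ha : IsIdempotentElem (x * y) := by rw [IsIdempotentElem, ← mul_assoc, hx]
  have hb : IsIdempotentElem (y * x) := by rw [IsIdempotentElem, ← mul_assoc, hy]
  simp only [Set.mem_iUnion]
  refine ⟨⟨x * y, ha⟩, fun hle => hfx ?_, ⟨y * x, hb⟩, fun hle => hxf ?_,
    hsub _ _ ⟨y, hx, hy, rfl, rfl⟩⟩
  · have h : f * (x * y) = x * y := hle.2
    calc f * x = f * (x * y) * x := by rw [mul_assoc, hx]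
      _ = x := by rw [h, hx]
  · have h : y * x * f = y * x := hle.1
    calc x * f = x * (y * x * f) := by rw [← mul_assoc, ← mul_assoc, hx]
      _ = x := by rw [h, ← mul_assoc, hx]

/-- The greatest idempotent of an inverse `ω`-semigroup is an identity. -/
theorem exists_one (hinv : IsInverse S) (homega : IsOmegaSemigroup S) :
    ∃ e : S, ∀ x, e * x = x ∧ x * e = x := by
  obtain ⟨φ⟩ := homega
  refine ⟨φ.symm 0, fun x => ?_⟩
  obtain ⟨y, ⟨hx, hy⟩, -⟩ := hinv x
  have ha : IsIdempotentElem (x * y) := by rw [IsIdempotentElem, ← mul_assoc, hx]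
  have hb : IsIdempotentElem (y * x) := by rw [IsIdempotentElem, ← mul_assoc, hy]
  have top (e : {e : S // IsIdempotentElem e}) : IdempotentLE e (φ.symm 0) := by
    rw [← φ.map_rel_iff]
    simp
  have h1 : φ.symm 0 * (x * y) = x * y := (top ⟨_, ha⟩).2
  have h2 : y * x * φ.symm 0 = y * x := (top ⟨_, hb⟩).1
  constructor
  · calc φ.symm 0 * x = φ.symm 0 * (x * y) * x := by rw [mul_assoc, hx]
      _ = x := by rw [h1, hx]
  · calc x * φ.symm 0 = x * (y * x * φ.symm 0) := by rw [← mul_assoc, ← mul_assoc, hx]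
      _ = x := by rw [h2, ← mul_assoc, hx]

end Algebra

/-! ### The bicyclic pair and its decreasing idempotents -/

section Bicyclic

variable {S : Type*} [Monoid S]

theorem isIdempotentElem_pow_mul_pow {p q : S} (hpq : p * q = 1) (n : ℕ) :
    IsIdempotentElem (q ^ n * p ^ n) := by
  rw [IsIdempotentElem, mul_assoc, ← mul_assoc (p ^ n), pow_mul_pow_eq_one n hpq, one_mul]

theorem pow_mul_pow_mul_of_le {p q : S} (hpq : p * q = 1) {m n : ℕ} (h : m ≤ n) :
    q ^ m * p ^ m * q ^ n = q ^ n := by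
  obtain ⟨k, rfl⟩ := Nat.exists_eq_add_of_le h
  rw [pow_add, ← mul_assoc, mul_assoc (q ^ m) (p ^ m), pow_mul_pow_eq_one m hpq, mul_one]

theorem mul_pow_mul_pow_of_le {p q : S} (hpq : p * q = 1) {m n : ℕ} (h : m ≤ n) :
    p ^ n * (q ^ m * p ^ m) = p ^ n := by
  obtain ⟨k, rfl⟩ := Nat.exists_eq_add_of_le' h
  rw [pow_add, mul_assoc, ← mul_assoc (p ^ m), pow_mul_pow_eq_one m hpq, one_mul]

/-- A simple `ω`-monoid contains a copy of the bicyclic monoid. -/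
theorem exists_mul_eq_one_mul_ne_one (hsimple : IsSimple S) (homega : IsOmegaSemigroup S) :
    ∃ p q : S, p * q = 1 ∧ q * p ≠ 1 := by
  obtain ⟨e, he, hne⟩ : ∃ e : S, IsIdempotentElem e ∧ e ≠ 1 := by
    obtain ⟨φ⟩ := homega
    by_contra! hcon
    have h : φ.symm 0 = φ.symm 1 :=
      Subtype.ext ((hcon _ (φ.symm 0).2).trans (hcon _ (φ.symm 1).2).symm)
    simpa using φ.symm.injective h
  -- The ideal `SeS` contains `1 = a e b`; put `p = a e`, `q = e b`. As `e` fixes `q p` on the left,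
  -- `q p = 1` would force `e = 1`.
  have huniv := hsimple {x | ∃ a b, x = a * e * b} ⟨e, 1, 1, by simp⟩ (by
    rintro c _ ⟨a, b, rfl⟩
    exact ⟨⟨c * a, b, by simp only [mul_assoc]⟩, ⟨a, b * c, by simp only [mul_assoc]⟩⟩)
  obtain ⟨a, b, hab⟩ : (1 : S) ∈ {x | ∃ a b, x = a * e * b} := huniv ▸ Set.mem_univ _
  refine ⟨a * e, e * b, ?_, fun hcon => hne ?_⟩
  · rw [mul_assoc, ← mul_assoc e, he.eq, ← mul_assoc, ← hab]
  · calc e = e * (e * b * (a * e)) := by rw [hcon, mul_one]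
      _ = e * b * (a * e) := by rw [← mul_assoc, ← mul_assoc e, he.eq]
      _ = 1 := hcon

/-- Every idempotent of an `ω`-monoid fails to lie below some `qⁿpⁿ`. -/
theorem exists_not_idempotentLE_pow_mul_pow (homega : IsOmegaSemigroup S) {p q : S}
    (hpq : p * q = 1) (hqp : q * p ≠ 1) (e : {e : S // IsIdempotentElem e}) :
    ∃ n, ¬ IdempotentLE e ⟨q ^ n * p ^ n, isIdempotentElem_pow_mul_pow hpq n⟩ := by
  refine homega.exists_not_idempotentLE
    (fun n => ⟨q ^ n * p ^ n, isIdempotentElem_pow_mul_pow hpq n⟩) (fun n => ⟨?_, ?_⟩)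
    (fun n heq => hqp ?_) e
  · change q ^ (n + 1) * p ^ (n + 1) * (q ^ n * p ^ n) = q ^ (n + 1) * p ^ (n + 1)
    rw [mul_assoc, mul_pow_mul_pow_of_le hpq n.le_succ]
  · change q ^ n * p ^ n * (q ^ (n + 1) * p ^ (n + 1)) = q ^ (n + 1) * p ^ (n + 1)
    rw [← mul_assoc, pow_mul_pow_mul_of_le hpq n.le_succ]
  · have h : q ^ (n + 1) * p ^ (n + 1) = q ^ n * p ^ n := congrArg Subtype.val heq
    have hn := pow_mul_pow_eq_one n hpq
    calc q * p = (p ^ n * q ^ n) * (q * p) * (p ^ n * q ^ n) := by rw [hn, one_mul, mul_one]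
      _ = p ^ n * (q ^ (n + 1) * p ^ (n + 1)) * q ^ n := by
        rw [pow_succ, pow_succ' p]; simp only [mul_assoc]
      _ = (p ^ n * q ^ n) * (p ^ n * q ^ n) := by rw [h]; simp only [mul_assoc]
      _ = 1 := by rw [hn, one_mul]

/-- If `qⁿpⁿ` fixes `x` on the right, it fixes `y x` on the right; since idempotents form a chain,
this one-sided relation already gives `y x ≼ qⁿpⁿ`. -/
theorem exists_mul_pow_mul_pow_ne (hinv : IsInverse S) (homega : IsOmegaSemigroup S) {p q : S}
    (hpq : p * q = 1) (hqp : q * p ≠ 1) (x : S) : ∃ n, x * (q ^ n * p ^ n) ≠ x := by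
  obtain ⟨y, ⟨hx, hy⟩, -⟩ := hinv x
  have hb : IsIdempotentElem (y * x) := by rw [IsIdempotentElem, ← mul_assoc, hy]
  obtain ⟨n, hn⟩ := exists_not_idempotentLE_pow_mul_pow homega hpq hqp ⟨_, hb⟩
  refine ⟨n, fun h => ?_⟩
  have h' : y * x * (q ^ n * p ^ n) = y * x := by rw [mul_assoc, h]
  obtain hle | hle := homega.idempotentLE_total ⟨_, hb⟩
    ⟨q ^ n * p ^ n, isIdempotentElem_pow_mul_pow hpq n⟩
  · exact hn hle
  · have h2 : y * x * (q ^ n * p ^ n) = q ^ n * p ^ n := hle.2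
    refine hn ⟨h', ?_⟩
    change q ^ n * p ^ n * (y * x) = y * x
    rw [← h', h2, (isIdempotentElem_pow_mul_pow hpq n).eq]

theorem exists_pow_mul_pow_mul_ne (hinv : IsInverse S) (homega : IsOmegaSemigroup S) {p q : S}
    (hpq : p * q = 1) (hqp : q * p ≠ 1) (x : S) : ∃ n, q ^ n * p ^ n * x ≠ x := by
  obtain ⟨y, ⟨hx, hy⟩, -⟩ := hinv x
  have hb : IsIdempotentElem (x * y) := by rw [IsIdempotentElem, ← mul_assoc, hx]
  obtain ⟨n, hn⟩ := exists_not_idempotentLE_pow_mul_pow homega hpq hqp ⟨_, hb⟩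
  refine ⟨n, fun h => ?_⟩
  have h' : q ^ n * p ^ n * (x * y) = x * y := by rw [← mul_assoc, h]
  obtain hle | hle := homega.idempotentLE_total ⟨_, hb⟩
    ⟨q ^ n * p ^ n, isIdempotentElem_pow_mul_pow hpq n⟩
  · exact hn hle
  · have h2 : q ^ n * p ^ n * (x * y) = q ^ n * p ^ n := hle.1
    refine hn ⟨?_, h'⟩
    change x * y * (q ^ n * p ^ n) = x * y
    rw [← h', h2, (isIdempotentElem_pow_mul_pow hpq n).eq]

end Bicyclic

/-! ### Compactness and the limit argument -/

section Topology

open Filter Topology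

variable {S : Type*} [Monoid S] [TopologicalSpace S] [T2Space S] [SeparatelyContinuousMul S]

/-- A compact set avoids `qⁿS ∪ Spⁿ` for large `n`, if every point does. -/
theorem exists_forall_mul_ne_of_isCompact {p q : S} (hpq : p * q = 1)
    (hL : ∀ x : S, ∃ n, x * (q ^ n * p ^ n) ≠ x) (hR : ∀ x : S, ∃ n, q ^ n * p ^ n * x ≠ x)
    {K : Set S} (hK : IsCompact K) :
    ∃ n, ∀ x ∈ K, x * (q ^ n * p ^ n) ≠ x ∧ q ^ n * p ^ n * x ≠ x := by
  have hLm {x : S} {m n : ℕ} (hmn : m ≤ n) (h : x * (q ^ n * p ^ n) = x) :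
      x * (q ^ m * p ^ m) = x := by
    rw [← h, mul_assoc, mul_assoc (q ^ n), mul_pow_mul_pow_of_le hpq hmn]
  have hRm {x : S} {m n : ℕ} (hmn : m ≤ n) (h : q ^ n * p ^ n * x = x) :
      q ^ m * p ^ m * x = x := by
    rw [← h, ← mul_assoc, ← mul_assoc (q ^ m * p ^ m), pow_mul_pow_mul_of_le hpq hmn]
  let W : ℕ → Set S := fun n => {x | x * (q ^ n * p ^ n) ≠ x ∧ q ^ n * p ^ n * x ≠ x}
  have hWmono : Monotone W := fun m n hmn x hx =>
    ⟨fun h => hx.1 (hLm hmn h), fun h => hx.2 (hRm hmn h)⟩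
  have hWopen (n : ℕ) : IsOpen (W n) :=
    (isOpen_ne_fun (continuous_mul_const _) continuous_id).inter
      (isOpen_ne_fun (continuous_const_mul _) continuous_id)
  have hcover : K ⊆ ⋃ n, W n := fun x _ => by
    obtain ⟨m, hm⟩ := hL x
    obtain ⟨n, hn⟩ := hR x
    exact Set.mem_iUnion.2 ⟨max m n, fun h => hm (hLm (le_max_left _ _) h),
      fun h => hn (hRm (le_max_right _ _) h)⟩
  obtain ⟨n, hn⟩ := hK.elim_directed_cover W hWopen hcover hWmono.directed_le
  exact ⟨n, fun x hx => hn hx⟩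

/-- If the elements outside `qⁿS ∪ Spⁿ` are relatively compact and escape every point as `n` grows,
then a compact ideal complementing `S` in a locally compact semigroup is open. -/
theorem isOpen_of_isCompact_ideal {p q : S} (hpq : p * q = 1)
    (hL : ∀ x : S, ∃ n, x * (q ^ n * p ^ n) ≠ x) (hR : ∀ x : S, ∃ n, q ^ n * p ^ n * x ≠ x)
    (hC : ∀ n, ∃ C : Set S, IsCompact C ∧
      ∀ x, x * (q ^ n * p ^ n) ≠ x → q ^ n * p ^ n * x ≠ x → x ∈ C)
    {X : Type*} [Semigroup X] [TopologicalSpace X] [T2Space X] [LocallyCompactSpace X]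
    [ContinuousMul X] (j : S →ₙ* X) (hj : IsEmbedding j) (I : Set X)
    (hcompl : IsCompl (Set.range j) I) (hideal : IsTwoSidedIdeal I) (hI : IsCompact I) :
    IsOpen I := by
  by_contra hnot
  have hrange : Set.range j = Iᶜ := hcompl.eq_compl
  have hjI (x : S) : j x ∉ I := by
    rw [← Set.mem_compl_iff, ← hrange]
    exact Set.mem_range_self x
  obtain ⟨U, hU, hIU⟩ := exists_compact_superset hI
  let V : Set X := {x | x ∈ interior U ∧ x * j p ∈ interior U ∧ j q * x ∈ interior U}
  have hV : IsOpen V := isOpen_interior.inter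
    ((isOpen_interior.preimage (continuous_mul_const (j p))).inter
      (isOpen_interior.preimage (continuous_const_mul (j q))))
  have hIV : I ⊆ V := fun x hx => ⟨hIU hx, hIU (hideal _ x hx).2, hIU (hideal _ x hx).1⟩
  -- `U \ V` misses `I`, so it is a compact part of `S`; beyond it, one step by `p` or `q` stays in
  -- `U`.
  have hK : IsCompact (j ⁻¹' (U \ V)) := by
    refine hj.isInducing.isCompact_preimage' (hU.diff hV) ?_
    rw [hrange]
    exact fun x hx hxI => hx.2 (hIV hxI)
  obtain ⟨N, hN⟩ := exists_forall_mul_ne_of_isCompact hpq hL hR hK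
  have hVmem {x : S} (hx : j x ∈ U) (h : x * (q ^ N * p ^ N) = x ∨ q ^ N * p ^ N * x = x) :
      j x ∈ V := by
    by_contra hcon
    exact h.elim (hN x ⟨hx, hcon⟩).1 (hN x ⟨hx, hcon⟩).2
  have hright {x : S} (hx : j x ∈ U) (h : q ^ N * p ^ N * x = x) (n : ℕ) : j (x * p ^ n) ∈ U := by
    induction n with
    | zero => simpa using hx
    | succ n ih =>
      rw [pow_succ, ← mul_assoc, map_mul]
      exact interior_subset (hVmem ih (.inr (by rw [← mul_assoc, h]))).2.1
  have hleft {x : S} (hx : j x ∈ U) (h : x * (q ^ N * p ^ N) = x) (n : ℕ) : j (q ^ n * x) ∈ U := by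
    induction n with
    | zero => simpa using hx
    | succ n ih =>
      rw [pow_succ', mul_assoc, map_mul]
      exact interior_subset (hVmem ih (.inl (by rw [mul_assoc, h]))).2.2
  have hpL (x : S) : x * p ^ N * (q ^ N * p ^ N) = x * p ^ N := by
    rw [mul_assoc, mul_pow_mul_pow_of_le hpq le_rfl]
  have hqR (x : S) : q ^ N * p ^ N * (q ^ N * x) = q ^ N * x := by
    rw [← mul_assoc, pow_mul_pow_mul_of_le hpq le_rfl]
  obtain ⟨C, hCc, hCN⟩ := hC N
  obtain ⟨x, hxU, hxR⟩ : ∃ x : S, j x ∈ U ∧ q ^ N * p ^ N * x = x := by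
    -- Were this open set disjoint from `S`, it would equal `I`.
    have hopen : IsOpen (interior U \ j '' C) :=
      isOpen_interior.sdiff (hCc.image hj.continuous).isClosed
    obtain ⟨z, ⟨hzU, hzC⟩, hzI⟩ : ∃ z ∈ interior U \ j '' C, z ∉ I := by
      by_contra! hcon
      have heq : interior U \ j '' C = I :=
        Set.Subset.antisymm hcon fun z hz => ⟨hIU hz, by rintro ⟨s, -, rfl⟩; exact hjI s hz⟩
      exact hnot (heq ▸ hopen)
    obtain ⟨x, rfl⟩ : z ∈ Set.range j := hrange ▸ hzI
    by_cases h1 : q ^ N * p ^ N * x = x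
    · exact ⟨x, interior_subset hzU, h1⟩
    by_cases h2 : x * (q ^ N * p ^ N) = x
    · exact ⟨q ^ N * x, hleft (interior_subset hzU) h2 N, hqR x⟩
    · exact absurd ⟨x, hCN x h2 h1, rfl⟩ hzC
  let y := x * p ^ N
  let 𝒰 : Ultrafilter ℕ := hyperfilter ℕ
  obtain ⟨a, -, ha⟩ := hU.ultrafilter_le_nhds (𝒰.map fun n => j (x * p ^ n))
    (le_principal_iff.2 (mem_map.2 (univ_mem' fun n => hright hxU hxR n)))
  obtain ⟨b, -, hb⟩ := hU.ultrafilter_le_nhds (𝒰.map fun n => j (q ^ n * y))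
    (le_principal_iff.2 (mem_map.2 (univ_mem' fun n => hleft (hright hxU hxR N) (hpL x) n)))
  have ha' : Tendsto (fun n => j (x * p ^ n)) 𝒰 (𝓝 a) := ha
  have hb' : Tendsto (fun n => j (q ^ n * y)) 𝒰 (𝓝 b) := hb
  have hconst (n : ℕ) : j (x * p ^ n) * j (q ^ n * y) = j (x * y) := by
    rw [← map_mul, mul_assoc, ← mul_assoc (p ^ n), pow_mul_pow_eq_one n hpq, one_mul]
  have hab : a * b = j (x * y) :=
    tendsto_nhds_unique (ha'.mul hb') (by simp only [hconst]; exact tendsto_const_nhds)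
  have haI : a ∉ I := fun h => hjI (x * y) (hab ▸ (hideal b a h).2)
  obtain ⟨s, rfl⟩ : a ∈ Set.range j := hrange ▸ haI
  have hs : Tendsto (fun n => x * p ^ n) 𝒰 (𝓝 s) := hj.tendsto_nhds_iff.2 ha'
  obtain ⟨m, hm⟩ := hL s
  -- For `n ≥ m` the idempotent `qᵐpᵐ` fixes `x pⁿ` on the right, hence also the limit `s`.
  refine hm (tendsto_nhds_unique (hs.mul_const (q ^ m * p ^ m)) (hs.congr' ?_))
  have hlarge : ∀ᶠ n in (𝒰 : Filter ℕ), m ≤ n :=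
    Nat.hyperfilter_le_atTop (eventually_ge_atTop m)
  filter_upwards [hlarge] with n hn
  rw [mul_assoc, mul_pow_mul_pow_of_le hpq hn]

end Topology

end SemigroupTheory

/-- `X` is the semigroup `S ⊔ I`: the topological semigroup `S` is embedded in `X` by `j`, and
the compact ideal `I` is the complement of its image. -/
theorem corollary4p7
    {S : Type*} [Semigroup S] [TopologicalSpace S] [T2Space S] [SeparatelyContinuousMul S]
    (hinv : SemigroupTheory.IsInverse S) (hsimple : SemigroupTheory.IsSimple S)
    (homega : SemigroupTheory.IsOmegaSemigroup S)
    (hcompact : ∀ H : Set S, SemigroupTheory.IsMaximalSubgroup H → IsCompact H)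
    {X : Type*} [Semigroup X] [TopologicalSpace X] [T2Space X] [LocallyCompactSpace X]
    [ContinuousMul X]
    (j : S →ₙ* X) (hj : Topology.IsEmbedding j)
    (I : Set X) (hcompl : IsCompl (Set.range j) I)
    (hideal : SemigroupTheory.IsTwoSidedIdeal I) (hI : IsCompact I) :
    IsOpen I := by
  obtain ⟨e, he⟩ := SemigroupTheory.exists_one hinv homega
  let _ : Monoid S :=
    { ‹Semigroup S› with
      one := e
      one_mul := fun x => (he x).1
      mul_one := fun x => (he x).2 }
  obtain ⟨p, q, hpq, hqp⟩ := SemigroupTheory.exists_mul_eq_one_mul_ne_one (S := S) hsimple homega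
  exact SemigroupTheory.isOpen_of_isCompact_ideal hpq
    (SemigroupTheory.exists_mul_pow_mul_pow_ne hinv homega hpq hqp)
    (SemigroupTheory.exists_pow_mul_pow_mul_ne hinv homega hpq hqp)
    (fun n => SemigroupTheory.exists_isCompact_of_mul_ne hinv homega hcompact
      (SemigroupTheory.isIdempotentElem_pow_mul_pow hpq n))
    j hj I hcompl hideal hI
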